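/- For $c\in\mathbb C$ and $\rho>0$ write $D(c,\rho)=\{z\in\mathbb C:|z-c|<\rho\}$, and let $\mathbb D=D(0,1)$. For a simply connected domain $\Omega\subsetneq\mathbb C$ let $h_\Omega$ be the hyperbolic distance of $\Omega$ with curvature $-4$, that is, $h_\Omega(z,w)=\inf_\gamma\int_\gamma\lambda_\Omega(\zeta)\,|d\zeta|$ over the $C^1$ arcs $\gamma$ in $\Omega$ from $z$ to $w$, where $\lambda_\Omega(\zeta)=\dfrac{|\varphi'(\zeta)|}{1-|\varphi(\zeta)|^2}$ for any conformal map $\varphi$ of $\Omega$ onto $\mathbb D$. Let $\Omega\subset\mathbb C$ be a simply connected convex domain with $0\in\Omega$ and with $C^{1,1}$-smooth boundary (the boundary is a simple closed curve whose unit speed parametrization has Lipschitz continuous derivative). We say that $\Omega$ satisfies the $(R_O,R_I,R_C)$ condition if $R_O,R_I,R_C$ are all positive, $R_O$ is the minimal $\rho$ such that $\Omega\subset D(0,\rho)$, $R_I$ is the maximal $\rho$ such that $D(0,\rho)\subset\Omega$, and $\Omega$ can be expressed as a union of open disks of radius $R_C$. **Theorem.** Let $\Omega$ satisfy the $(R_O,R_I,R_C)$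 condition and let $a$ be any point such that $D(a,R_C)\subset\Omega$. Let $R=\max(R_C,R_I)$, $r=\min(R_C,R_I)$, $d=R_O-R_C$, and, when $r<R$, $\theta=\arcsin\frac{R-r}{d}$. Define $$F(R_O,R_I,R_C)=\begin{cases}\dfrac dR & \text{if } r=R,\\[2mm] \dfrac12\log\dfrac{R+d}{R-d} & \text{if } r<R \text{ and } d\le R\tan\dfrac\theta2,\\[2mm] \dfrac12\left[\cot\dfrac\theta2\,\log\left(\dfrac Rr\cos\theta\right)+\log\dfrac{1+\tan(\theta/2)}{1-\tan(\theta/2)}\right] & \text{if } r<R \text{ and } d>R\tan\dfrac\theta2.\end{cases}$$ Then $h_\Omega(0,a)\le F(R_O,R_I,R_C)$. -/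

import Mathlib

open Set Metric

noncomputable section

/-- `φ` maps the plane set `U` conformally (holomorphically and bijectively) onto `V`. -/
def IsConformalOnto (φ : ℂ → ℂ) (U V : Set ℂ) : Prop :=
  DifferentiableOn ℂ φ U ∧ BijOn φ U V

/-- The density at `z` of the hyperbolic metric (of curvature `-4`) of a simply connected domain
`Ω ≠ ℂ`: the number `|φ'(z)| / (1 - |φ(z)|²)`, where `φ` is a conformal map of `Ω` onto the unit
disk. Such a `φ` exists by the Riemann mapping theorem, and the number is the same for all of them,
so that the set below has exactly one element, which `sInf` extracts. -/
def hyperbolicDensity (Ω : Set ℂ) (z : ℂ) : ℝ :=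
  sInf {x : ℝ | ∃ φ : ℂ → ℂ, IsConformalOnto φ Ω (ball 0 1) ∧
    x = ‖deriv φ z‖ / (1 - ‖φ z‖ ^ 2)}

/-- The hyperbolic length of the arc `γ t`, `0 ≤ t ≤ 1`. -/
def hyperbolicLength (Ω : Set ℂ) (γ : ℝ → ℂ) : ℝ :=
  ∫ t in (0 : ℝ)..1, hyperbolicDensity Ω (γ t) * ‖deriv γ t‖

/-- The hyperbolic distance between two points of a simply connected domain `Ω ≠ ℂ`: the infimum of
the hyperbolic lengths of the `C¹` arcs in `Ω` that join the points. -/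
def hyperbolicDist (Ω : Set ℂ) (z w : ℂ) : ℝ :=
  sInf {l : ℝ | ∃ γ : ℝ → ℂ, ContDiff ℝ 1 γ ∧ γ 0 = z ∧ γ 1 = w ∧
    (∀ t ∈ Icc (0 : ℝ) 1, γ t ∈ Ω) ∧ l = hyperbolicLength Ω γ}

/-- The boundary of the bounded simply connected domain `Ω` is `C^{1,1}`-smooth: it is a simple
closed curve whose unit speed parametrization `w` (taken as an `L`-periodic function on the line)
has a Lipschitz continuous derivative. -/
def HasC11Boundary (Ω : Set ℂ) : Prop :=
  ∃ (L : ℝ) (w w' : ℝ → ℂ) (K : NNReal), 0 < L ∧ Function.Periodic w L ∧ InjOn w (Ico 0 L) ∧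
    range w = frontier Ω ∧ (∀ t, HasDerivAt w (w' t) t) ∧ (∀ t, ‖w' t‖ = 1) ∧ LipschitzWith K w'

/-- The `(R_O, R_I, R_C)` condition on a plane domain. -/
structure RadiiCondition (Ω : Set ℂ) (R_O R_I R_C : ℝ) : Prop where
  isOpen : IsOpen Ω
  simplyConnected : IsSimplyConnected Ω
  convex : Convex ℝ Ω
  zero_mem : (0 : ℂ) ∈ Ω
  c11Boundary : HasC11Boundary Ω
  outer_pos : 0 < R_O
  inner_pos : 0 < R_I
  curvature_pos : 0 < R_C
  outer : IsLeast {r : ℝ | Ω ⊆ ball 0 r} R_O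
  inner : IsGreatest {r : ℝ | ball 0 r ⊆ Ω} R_I
  curvature : ∃ A : Set ℂ, Ω = ⋃ a ∈ A, ball a R_C

/-- The bound `F(R_O, R_I, R_C)`. -/
def radiiBound (R_O R_I R_C : ℝ) : ℝ :=
  let R := max R_C R_I
  let r := min R_C R_I
  let d := R_O - R_C
  let θ := Real.arcsin ((R - r) / d)
  if r = R then
    d / R
  else if d ≤ R * Real.tan (θ / 2) then
    (1 / 2) * Real.log ((R + d) / (R - d))
  else
    (1 / 2) * (Real.cot (θ / 2) * Real.log (R / r * Real.cos θ)
      + Real.log ((1 + Real.tan (θ / 2)) / (1 - Real.tan (θ / 2))))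

end

open ComplexConjugate

/-! By convexity, `Ω` contains every disk interpolating between `D(0, R_I)` and `D(a, R_C)`, with
centre on the segment `[0, a]` and radius affine in the centre. By Schwarz-Pick
(`norm_deriv_div_le_of_mapsTo_ball`) each of these disks bounds the density at the points of the
segment inside it, so it suffices to pick a good disk for each point and integrate.

Start from the centre of the larger disk. At distance `x` from the centre of a disk of radius `ρ`
the bound is `ρ / (ρ² - x²)`. It is stationary along the family when `τ = x / ρ` satisfies `(R -
r)(1 + τ²) = 2τd`, that is `τ = tan (θ/2)` with `sin θ = (R - r) / d`. Up to distance `Rτ` the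
larger disk itself is used, and beyond it the disk with `x = τρ`. Hence the case split in `F`. -/

/-! ### Disk automorphisms and the Schwarz-Pick lemma. -/

theorem one_add_conj_mul_ne_zero {b w : ℂ} (hb : ‖b‖ < 1) (hw : ‖w‖ < 1) :
    1 + conj b * w ≠ 0 := by
  intro h
  have h1 : conj b * w = -1 := by linear_combination h
  have h2 : ‖b‖ * ‖w‖ = 1 := by simpa using congrArg norm h1
  nlinarith [norm_nonneg b, norm_nonneg w]

/-- The automorphism of the unit disk that maps `0` to `b`. -/
noncomputable def diskAutomorphism (b w : ℂ) : ℂ := (w + b) / (1 + conj b * w)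

theorem norm_diskAutomorphism_lt_one {b w : ℂ} (hb : ‖b‖ < 1) (hw : ‖w‖ < 1) :
    ‖diskAutomorphism b w‖ < 1 := by
  have h0 : 0 < ‖1 + conj b * w‖ := norm_pos_iff.2 (one_add_conj_mul_ne_zero hb hw)
  rw [diskAutomorphism, norm_div, div_lt_one h0]
  refine lt_of_pow_lt_pow_left₀ 2 h0.le ?_
  have key : ‖1 + conj b * w‖ ^ 2 - ‖w + b‖ ^ 2 = (1 - ‖b‖ ^ 2) * (1 - ‖w‖ ^ 2) := by
    simp only [Complex.sq_norm, Complex.normSq_apply, Complex.add_re, Complex.add_im,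
      Complex.mul_re, Complex.mul_im, Complex.conj_re, Complex.conj_im, Complex.one_re,
      Complex.one_im]
    ring
  have hb' : 0 < 1 - ‖b‖ ^ 2 := by nlinarith [norm_nonneg b]
  have hw' : 0 < 1 - ‖w‖ ^ 2 := by nlinarith [norm_nonneg w]
  nlinarith [mul_pos hb' hw']

theorem hasDerivAt_diskAutomorphism {b w : ℂ} (h : 1 + conj b * w ≠ 0) :
    HasDerivAt (diskAutomorphism b) ((1 - conj b * b) / (1 + conj b * w) ^ 2) w := by
  have h1 : HasDerivAt (fun w : ℂ => w + b) 1 w := (hasDerivAt_id w).add_const b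
  have h2 : HasDerivAt (fun w : ℂ => 1 + conj b * w) (conj b) w := by
    simpa using ((hasDerivAt_id w).const_mul (conj b)).const_add 1
  convert! h1.div h2 h using 1
  ring

/-- The **Schwarz-Pick lemma**, infinitesimal form, for maps of a disk into the unit disk. -/
theorem norm_deriv_div_le_of_mapsTo_ball {φ : ℂ → ℂ} {c z : ℂ} {ρ : ℝ}
    (hd : DifferentiableOn ℂ φ (ball c ρ)) (hm : MapsTo φ (ball c ρ) (ball 0 1))
    (hz : z ∈ ball c ρ) :
    ‖deriv φ z‖ / (1 - ‖φ z‖ ^ 2) ≤ ρ / (ρ ^ 2 - ‖z - c‖ ^ 2) := by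
  have hρ : 0 < ρ := nonempty_ball.1 ⟨z, hz⟩
  have hzc : ‖z - c‖ < ρ := mem_ball_iff_norm.1 hz
  have hρ' : (ρ : ℂ) ≠ 0 := by exact_mod_cast hρ.ne'
  set b : ℂ := (z - c) / ρ with hb_def
  have hbn : ‖b‖ = ‖z - c‖ / ρ := by
    rw [hb_def, norm_div, Complex.norm_real, Real.norm_of_nonneg hρ.le]
  have hb : ‖b‖ < 1 := by rwa [hbn, div_lt_one hρ]
  have hu : ‖φ z‖ < 1 := mem_ball_zero_iff.1 (hm hz)
  have hu' : 0 < 1 - ‖φ z‖ ^ 2 := by nlinarith [norm_nonneg (φ z)]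
  let ψ : ℂ → ℂ := fun w => c + ρ * diskAutomorphism b w
  have hψ0 : ψ 0 = z := by
    simp only [ψ, diskAutomorphism, hb_def]
    field_simp
    simp
  have hψm : MapsTo ψ (ball 0 1) (ball c ρ) := by
    intro w hw
    have := norm_diskAutomorphism_lt_one hb (mem_ball_zero_iff.1 hw)
    rw [mem_ball_iff_norm]
    simp only [ψ, add_sub_cancel_left, norm_mul, Complex.norm_real, Real.norm_of_nonneg hρ.le]
    nlinarith
  have hψd : ∀ w ∈ ball (0 : ℂ) 1,
      HasDerivAt ψ (ρ * ((1 - conj b * b) / (1 + conj b * w) ^ 2)) w := fun w hw =>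
    ((hasDerivAt_diskAutomorphism
      (one_add_conj_mul_ne_zero hb (mem_ball_zero_iff.1 hw))).const_mul (ρ : ℂ)).const_add c
  have hnu : ‖-φ z‖ < 1 := by rwa [norm_neg]
  -- Automorphisms on both sides move `z` and `φ z` to `0`, so the Schwarz lemma applies to `g` at
  -- `0`; the chain rule turns `‖g' 0‖ ≤ 1` into the claim.
  let g : ℂ → ℂ := fun w => diskAutomorphism (-φ z) (φ (ψ w))
  have hφd : ∀ x ∈ ball c ρ, HasDerivAt φ (deriv φ x) x := fun x hx =>
    (hd.differentiableAt (isOpen_ball.mem_nhds hx)).hasDerivAt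
  have hgd : ∀ w ∈ ball (0 : ℂ) 1, HasDerivAt g
      ((1 - conj (-φ z) * (-φ z)) / (1 + conj (-φ z) * φ (ψ w)) ^ 2 *
        (deriv φ (ψ w) * (ρ * ((1 - conj b * b) / (1 + conj b * w) ^ 2)))) w := by
    intro w hw
    have h1 := (hφd _ (hψm hw)).comp w (hψd w hw)
    exact (hasDerivAt_diskAutomorphism (one_add_conj_mul_ne_zero hnu
      (mem_ball_zero_iff.1 (hm (hψm hw))))).comp w h1
  have hg0 : g 0 = 0 := by simp [g, hψ0, diskAutomorphism]
  have h0 : (0 : ℂ) ∈ ball (0 : ℂ) 1 := mem_ball_self one_pos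
  have hle : ‖deriv g 0‖ ≤ 1 := by
    refine Complex.norm_deriv_le_one_of_mapsTo_ball (R := 1)
      (fun w hw => (hgd w hw).differentiableAt.differentiableWithinAt) ?_ one_pos
    rw [hg0]
    intro w hw
    exact mem_closedBall_zero_iff.2
      (norm_diskAutomorphism_lt_one hnu (mem_ball_zero_iff.1 (hm (hψm hw)))).le
  have hconj : ∀ x : ℂ, 1 - conj x * x = ((1 - ‖x‖ ^ 2 : ℝ) : ℂ) := fun x => by
    rw [Complex.conj_mul']; push_cast; ring
  have hb2 : 0 < 1 - ‖b‖ ^ 2 := by nlinarith [norm_nonneg b]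
  rw [(hgd 0 h0).deriv, hψ0, show 1 + conj (-φ z) * φ z = 1 - conj (φ z) * φ z by
      rw [map_neg]; ring, hconj, hconj, hconj, norm_neg, mul_zero, add_zero, one_pow, div_one,
    norm_mul, norm_mul, norm_mul, norm_div, norm_pow, Complex.norm_real, Complex.norm_real,
    Complex.norm_real, Real.norm_of_nonneg hρ.le, Real.norm_of_nonneg hu'.le,
    Real.norm_of_nonneg hb2.le, hbn] at hle
  have hzc2 : 0 < ρ ^ 2 - ‖z - c‖ ^ 2 := by nlinarith [norm_nonneg (z - c)]
  have heq : (1 - ‖φ z‖ ^ 2) / (1 - ‖φ z‖ ^ 2) ^ 2 *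
      (‖deriv φ z‖ * (ρ * (1 - (‖z - c‖ / ρ) ^ 2))) =
      ‖deriv φ z‖ / (1 - ‖φ z‖ ^ 2) * ((ρ ^ 2 - ‖z - c‖ ^ 2) / ρ) := by
    field_simp
  rw [heq] at hle
  rw [le_div_iff₀ hzc2]
  rwa [← mul_div_assoc, div_le_one hρ] at hle

/-! ### Hyperbolic density, length and distance. -/

theorem hyperbolicDensity_nonneg {Ω : Set ℂ} {z : ℂ} (hz : z ∈ Ω) :
    0 ≤ hyperbolicDensity Ω z := by
  refine Real.sInf_nonneg ?_
  rintro x ⟨φ, hφ, rfl⟩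
  have hu : ‖φ z‖ < 1 := mem_ball_zero_iff.1 (hφ.2.mapsTo hz)
  have : 0 < 1 - ‖φ z‖ ^ 2 := by nlinarith [norm_nonneg (φ z)]
  positivity

/-- The hyperbolic density of a domain is at most that of any disk that it contains. -/
theorem hyperbolicDensity_le_of_ball_subset {Ω : Set ℂ} {c z : ℂ} {ρ : ℝ} (hΩ : ball c ρ ⊆ Ω)
    (hz : z ∈ ball c ρ) : hyperbolicDensity Ω z ≤ ρ / (ρ ^ 2 - ‖z - c‖ ^ 2) := by
  have hle : ∀ x ∈ {x : ℝ | ∃ φ : ℂ → ℂ, IsConformalOnto φ Ω (ball 0 1) ∧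
      x = ‖deriv φ z‖ / (1 - ‖φ z‖ ^ 2)}, x ≤ ρ / (ρ ^ 2 - ‖z - c‖ ^ 2) := by
    rintro x ⟨φ, hφ, rfl⟩
    exact norm_deriv_div_le_of_mapsTo_ball (hφ.1.mono hΩ) (hφ.2.mapsTo.mono_left hΩ) hz
  have hpos : 0 ≤ ρ / (ρ ^ 2 - ‖z - c‖ ^ 2) := by
    have hzc : ‖z - c‖ < ρ := mem_ball_iff_norm.1 hz
    have hρ : 0 < ρ := (norm_nonneg _).trans_lt hzc
    have : 0 < ρ ^ 2 - ‖z - c‖ ^ 2 := by nlinarith [norm_nonneg (z - c)]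
    positivity
  unfold hyperbolicDensity
  rcases Set.eq_empty_or_nonempty {x : ℝ | ∃ φ : ℂ → ℂ, IsConformalOnto φ Ω (ball 0 1) ∧
      x = ‖deriv φ z‖ / (1 - ‖φ z‖ ^ 2)} with he | ⟨x, hx⟩
  -- Without any conformal map the infimum defaults to `0`, so the Riemann mapping theorem is not
  -- needed.
  · rwa [he, Real.sInf_empty]
  · refine (csInf_le ⟨0, ?_⟩ hx).trans (hle x hx)
    rintro x ⟨φ, hφ, rfl⟩
    have hu : ‖φ z‖ < 1 := mem_ball_zero_iff.1 (hφ.2.mapsTo (hΩ hz))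
    have : 0 < 1 - ‖φ z‖ ^ 2 := by nlinarith [norm_nonneg (φ z)]
    positivity

theorem hyperbolicLength_nonneg {Ω : Set ℂ} {γ : ℝ → ℂ} (hγ : ∀ t ∈ Icc (0 : ℝ) 1, γ t ∈ Ω) :
    0 ≤ hyperbolicLength Ω γ :=
  intervalIntegral.integral_nonneg zero_le_one fun t ht =>
    mul_nonneg (hyperbolicDensity_nonneg (hγ t ht)) (norm_nonneg _)

theorem hyperbolicLength_reverse (Ω : Set ℂ) (γ : ℝ → ℂ) :
    hyperbolicLength Ω (fun t => γ (1 - t)) = hyperbolicLength Ω γ := by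
  have h : ∀ t, deriv (fun t => γ (1 - t)) t = -deriv γ (1 - t) := fun t =>
    deriv_comp_const_sub ..
  simp only [hyperbolicLength, h, norm_neg]
  rw [intervalIntegral.integral_comp_sub_left
    (fun t => hyperbolicDensity Ω (γ t) * ‖deriv γ t‖) 1]
  simp

theorem hyperbolicDist_comm (Ω : Set ℂ) (z w : ℂ) :
    hyperbolicDist Ω z w = hyperbolicDist Ω w z := by
  have key : ∀ z w : ℂ, ∀ l, (∃ γ : ℝ → ℂ, ContDiff ℝ 1 γ ∧ γ 0 = z ∧ γ 1 = w ∧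
      (∀ t ∈ Icc (0 : ℝ) 1, γ t ∈ Ω) ∧ l = hyperbolicLength Ω γ) →
      ∃ γ : ℝ → ℂ, ContDiff ℝ 1 γ ∧ γ 0 = w ∧ γ 1 = z ∧
      (∀ t ∈ Icc (0 : ℝ) 1, γ t ∈ Ω) ∧ l = hyperbolicLength Ω γ := by
    rintro z w l ⟨γ, hγ, h0, h1, hΩ, hl⟩
    refine ⟨fun t => γ (1 - t), hγ.comp (contDiff_const.sub contDiff_id), by simpa, by simpa,
      fun t ht => hΩ _ ⟨by linarith [ht.2], by linarith [ht.1]⟩, ?_⟩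
    rw [hl, hyperbolicLength_reverse]
  exact congrArg sInf (Set.ext fun l => ⟨key z w l, key w z l⟩)

theorem hyperbolicDist_le_integral {Ω : Set ℂ} {p q : ℂ} {g : ℝ → ℝ}
    (hΩ : ∀ t ∈ Icc (0 : ℝ) 1, p + t * (q - p) ∈ Ω)
    (hg : IntervalIntegrable g MeasureTheory.volume 0 1)
    (hle : ∀ t ∈ Icc (0 : ℝ) 1, hyperbolicDensity Ω (p + t * (q - p)) * ‖q - p‖ ≤ g t) :
    hyperbolicDist Ω p q ≤ ∫ t in (0 : ℝ)..1, g t := by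
  set γ : ℝ → ℂ := fun t => p + t * (q - p) with hγ
  have hd : ∀ t : ℝ, HasDerivAt γ (q - p) t := fun t => by
    have h : HasDerivAt (fun t : ℝ => (t : ℂ) * (q - p)) (q - p) t := by
      simpa using (Complex.ofRealCLM.hasDerivAt (x := t)).mul_const (q - p)
    exact h.const_add p
  have hC : ContDiff ℝ 1 γ :=
    contDiff_const.add (Complex.ofRealCLM.contDiff.mul contDiff_const)
  have hmem : hyperbolicLength Ω γ ∈ {l : ℝ | ∃ γ : ℝ → ℂ, ContDiff ℝ 1 γ ∧ γ 0 = p ∧ γ 1 = q ∧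
      (∀ t ∈ Icc (0 : ℝ) 1, γ t ∈ Ω) ∧ l = hyperbolicLength Ω γ} :=
    ⟨γ, hC, by simp [hγ], by simp [hγ], hΩ, rfl⟩
  refine (csInf_le ⟨0, ?_⟩ hmem).trans ?_
  · rintro l ⟨γ, -, -, -, h, rfl⟩
    exact hyperbolicLength_nonneg h
  · simp only [hyperbolicLength, (hd _).deriv]
    rw [intervalIntegral.integral_of_le zero_le_one, intervalIntegral.integral_of_le zero_le_one]
    -- Only the majorant has to be integrable; no regularity of the density is needed.
    refine MeasureTheory.integral_mono_of_nonneg ?_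
      ((intervalIntegrable_iff_integrableOn_Ioc_of_le zero_le_one).1 hg) ?_
    · filter_upwards [MeasureTheory.ae_restrict_mem measurableSet_Ioc] with t ht
      exact mul_nonneg (hyperbolicDensity_nonneg (hΩ t ⟨ht.1.le, ht.2⟩)) (norm_nonneg _)
    · filter_upwards [MeasureTheory.ae_restrict_mem measurableSet_Ioc] with t ht
      exact hle t ⟨ht.1.le, ht.2⟩

/-! ### Interpolating disks in a convex set. -/

/-- A convex set that contains two disks contains the disks that interpolate between them. -/
theorem Convex.ball_interpolation_subset {Ω : Set ℂ} (hΩ : Convex ℝ Ω) {p q : ℂ} {R r w : ℝ}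
    (hR : 0 < R) (hr : 0 < r) (hp : ball p R ⊆ Ω) (hq : ball q r ⊆ Ω) (hw : w ∈ Icc (0 : ℝ) 1) :
    ball (p + w * (q - p)) ((1 - w) * R + w * r) ⊆ Ω := by
  intro x hx
  set ρ := (1 - w) * R + w * r with hρ_def
  have hρ : 0 < ρ := nonempty_ball.1 ⟨x, hx⟩
  -- `u` is the position of `x` in its disk, in units of the radius; `x` is a convex combination of
  -- the points at position `u` in the two given disks.
  set u : ℂ := (x - (p + w * (q - p))) / ρ with hu_def
  have hu : ‖u‖ < 1 := by
    rw [hu_def, norm_div, Complex.norm_real, Real.norm_of_nonneg hρ.le, div_lt_one hρ]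
    exact mem_ball_iff_norm.1 hx
  have h1 : p + R * u ∈ Ω := hp <| by
    rw [mem_ball_iff_norm, add_sub_cancel_left, norm_mul, Complex.norm_real,
      Real.norm_of_nonneg hR.le]
    nlinarith
  have h2 : q + r * u ∈ Ω := hq <| by
    rw [mem_ball_iff_norm, add_sub_cancel_left, norm_mul, Complex.norm_real,
      Real.norm_of_nonneg hr.le]
    nlinarith
  have h3 := hΩ h1 h2 (sub_nonneg.2 hw.2) hw.1 (sub_add_cancel 1 w)
  convert! h3 using 1
  have hρ' : (ρ : ℂ) ≠ 0 := by exact_mod_cast hρ.ne'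
  have hxu : x = p + w * (q - p) + ρ * u := by rw [hu_def]; field_simp; ring
  have hρc : (ρ : ℂ) = (1 - w) * R + w * r := by rw [hρ_def]; push_cast; ring
  rw [hxu, hρc, Complex.real_smul, Complex.real_smul]
  push_cast
  ring

/-- The bound increases with the distance of the centres, so an upper bound `d` for that distance
can replace it. The parameter `w` selects the disk and is left free to be optimized. -/
theorem hyperbolicDensity_mul_le {Ω : Set ℂ} (hΩ : Convex ℝ Ω) {p q : ℂ} {R r w d t : ℝ}
    (hR : 0 < R) (hr : 0 < r) (hp : ball p R ⊆ Ω) (hq : ball q r ⊆ Ω) (hpq : ‖q - p‖ ≤ d)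
    (hw : w ∈ Icc (0 : ℝ) 1) (ht : |t - w| * d < (1 - w) * R + w * r) :
    hyperbolicDensity Ω (p + t * (q - p)) * ‖q - p‖ ≤
      d * ((1 - w) * R + w * r) / (((1 - w) * R + w * r) ^ 2 - (d * (t - w)) ^ 2) := by
  set ρ := (1 - w) * R + w * r with hρ
  have hn := norm_nonneg (q - p)
  have hnorm : ‖p + t * (q - p) - (p + w * (q - p))‖ = |t - w| * ‖q - p‖ := by
    rw [show p + t * (q - p) - (p + w * (q - p)) = ((t - w : ℝ) : ℂ) * (q - p) by
      push_cast; ring, norm_mul, Complex.norm_real, Real.norm_eq_abs]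
  have habs : |t - w| * ‖q - p‖ ≤ |t - w| * d := by gcongr
  have hρ0 : 0 < ρ := lt_of_le_of_lt (mul_nonneg (abs_nonneg _) (hn.trans hpq)) ht
  have h1 := hyperbolicDensity_le_of_ball_subset
    (hΩ.ball_interpolation_subset hR hr hp hq hw) (z := p + t * (q - p))
    (by rw [mem_ball_iff_norm, hnorm]; linarith)
  rw [hnorm] at h1
  have h2 : (|t - w| * d) ^ 2 = (d * (t - w)) ^ 2 := by rw [mul_pow, sq_abs]; ring
  have h3 : 0 < ρ ^ 2 - (|t - w| * d) ^ 2 := by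
    have : 0 ≤ |t - w| * d := mul_nonneg (abs_nonneg _) (hn.trans hpq)
    nlinarith
  rw [← h2]
  calc _ ≤ ρ / (ρ ^ 2 - (|t - w| * ‖q - p‖) ^ 2) * ‖q - p‖ := by gcongr
    _ ≤ ρ / (ρ ^ 2 - (|t - w| * d) ^ 2) * d := by gcongr
    _ = _ := by ring

theorem Convex.add_mul_sub_mem {Ω : Set ℂ} (hΩ : Convex ℝ Ω) {p q : ℂ} {R r t : ℝ}
    (hR : 0 < R) (hr : 0 < r) (hp : ball p R ⊆ Ω) (hq : ball q r ⊆ Ω) (ht : t ∈ Icc (0 : ℝ) 1) :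
    p + t * (q - p) ∈ Ω :=
  hΩ.ball_interpolation_subset hR hr hp hq ht <| mem_ball_self <| by
    nlinarith [ht.1, ht.2, mul_nonneg (sub_nonneg.2 ht.2) hR.le, mul_nonneg ht.1 hr.le]

/-! ### Integrating the density bound in the three cases. -/

theorem hyperbolicDist_le_of_radius_eq {Ω : Set ℂ} (hΩ : Convex ℝ Ω) {p q : ℂ} {R d : ℝ}
    (hR : 0 < R) (hp : ball p R ⊆ Ω) (hq : ball q R ⊆ Ω) (hpq : ‖q - p‖ ≤ d) :
    hyperbolicDist Ω p q ≤ d / R := by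
  have h := hyperbolicDist_le_integral (g := fun _ => d / R)
    (fun t ht => hΩ.add_mul_sub_mem hR hR hp hq ht) intervalIntegrable_const fun t ht => by
      -- Here `w = t`: each point is the centre of its own disk of radius `R`.
      have h := hyperbolicDensity_mul_le hΩ hR hR hp hq hpq ht (t := t) (by simpa using by linarith)
      refine h.trans_eq ?_
      field_simp
      ring
  simpa using h

theorem integral_div_sq_sub_sq {R d s : ℝ} (hd : 0 ≤ d) (hs : 0 ≤ s) (hds : d * s < R) :
    IntervalIntegrable (fun t => d * R / (R ^ 2 - (d * t) ^ 2)) MeasureTheory.volume 0 s ∧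
    ∫ t in (0 : ℝ)..s, d * R / (R ^ 2 - (d * t) ^ 2) =
      1 / 2 * Real.log ((R + d * s) / (R - d * s)) := by
  have hR : 0 < R := (mul_nonneg hd hs).trans_lt hds
  have hlt : ∀ t ∈ uIcc 0 s, 0 ≤ d * t ∧ d * t < R := fun t ht => by
    rw [uIcc_of_le hs] at ht
    exact ⟨mul_nonneg hd ht.1, (mul_le_mul_of_nonneg_left ht.2 hd).trans_lt hds⟩
  have hpos : ∀ t ∈ uIcc 0 s, R ^ 2 - (d * t) ^ 2 ≠ 0 := fun t ht => by
    have := hlt t ht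
    nlinarith
  have hint : IntervalIntegrable (fun t => d * R / (R ^ 2 - (d * t) ^ 2))
      MeasureTheory.volume 0 s :=
    ContinuousOn.intervalIntegrable (continuousOn_const.div (by fun_prop) hpos)
  refine ⟨hint, ?_⟩
  have hderiv : ∀ t ∈ uIcc 0 s, HasDerivAt
      (fun t => 1 / 2 * (Real.log (R + d * t) - Real.log (R - d * t)))
      (d * R / (R ^ 2 - (d * t) ^ 2)) t := fun t ht => by
    obtain ⟨h1, h2⟩ := hlt t ht
    have hlin : HasDerivAt (fun t => d * t) d t := by simpa using (hasDerivAt_id t).const_mul d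
    have ha := (hlin.const_add R).log (by linarith)
    have hb := (hlin.const_sub R).log (by linarith)
    convert! (ha.sub hb).const_mul (1 / 2 : ℝ) using 1
    have h3 : R + d * t ≠ 0 := by linarith
    have h4 : R - d * t ≠ 0 := by linarith
    rw [show R ^ 2 - (d * t) ^ 2 = (R + d * t) * (R - d * t) by ring]
    field_simp
    ring
  rw [intervalIntegral.integral_eq_sub_of_hasDerivAt hderiv hint,
    Real.log_div (by linarith [mul_nonneg hd hs]) (by linarith)]
  simp

theorem hyperbolicDist_le_of_lt_radius {Ω : Set ℂ} (hΩ : Convex ℝ Ω) {p q : ℂ} {R r d : ℝ}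
    (hr : 0 < r) (hp : ball p R ⊆ Ω) (hq : ball q r ⊆ Ω) (hpq : ‖q - p‖ ≤ d) (hd : d < R) :
    hyperbolicDist Ω p q ≤ 1 / 2 * Real.log ((R + d) / (R - d)) := by
  have hd0 : 0 ≤ d := (norm_nonneg _).trans hpq
  have hR : 0 < R := hd0.trans_lt hd
  obtain ⟨hint, heq⟩ := integral_div_sq_sub_sq hd0 zero_le_one (by rwa [mul_one])
  rw [mul_one] at heq
  rw [← heq]
  refine hyperbolicDist_le_integral (fun t ht => hΩ.add_mul_sub_mem hR hr hp hq ht) hint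
    fun t ht => ?_
  -- `w = 0` selects the disk about `p` for the whole segment.
  have h := hyperbolicDensity_mul_le hΩ hR hr hp hq hpq (w := 0) (t := t) (by simp)
    (by rw [sub_zero, abs_of_nonneg ht.1]; nlinarith [ht.1, ht.2])
  simpa using h

theorem integral_div_sub_mul {R r d τ s : ℝ} (hτ : 0 < τ) (hr : 0 < r) (hrR : r < R)
    (hs : s ≤ 1) (h : (R - r) * (1 + τ ^ 2) = 2 * τ * d) :
    IntervalIntegrable (fun t => d / ((1 + τ ^ 2) * (R - (R - r) * t)))
      MeasureTheory.volume s 1 ∧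
    ∫ t in s..1, d / ((1 + τ ^ 2) * (R - (R - r) * t)) =
      1 / (2 * τ) * Real.log ((R - (R - r) * s) / r) := by
  have hpos : ∀ t ∈ uIcc s 1, 0 < R - (R - r) * t := fun t ht => by
    rw [uIcc_of_le hs] at ht
    nlinarith [ht.2]
  have hne : ∀ t ∈ uIcc s 1, (1 + τ ^ 2) * (R - (R - r) * t) ≠ 0 := fun t ht => by
    have := hpos t ht
    positivity
  have hint : IntervalIntegrable (fun t => d / ((1 + τ ^ 2) * (R - (R - r) * t)))
      MeasureTheory.volume s 1 :=
    ContinuousOn.intervalIntegrable (continuousOn_const.div (by fun_prop) hne)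
  refine ⟨hint, ?_⟩
  have hderiv : ∀ t ∈ uIcc s 1, HasDerivAt
      (fun t => -(1 / (2 * τ)) * Real.log (R - (R - r) * t))
      (d / ((1 + τ ^ 2) * (R - (R - r) * t))) t := fun t ht => by
    have h1 := hpos t ht
    have hlin : HasDerivAt (fun t => (R - r) * t) (R - r) t := by
      simpa using (hasDerivAt_id t).const_mul (R - r)
    convert! ((hlin.const_sub R).log h1.ne').const_mul (-(1 / (2 * τ))) using 1
    have h2 : (1 + τ ^ 2) ≠ 0 := by positivity
    have h3 := h1.ne'
    field_simp
    linear_combination -h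
  rw [intervalIntegral.integral_eq_sub_of_hasDerivAt hderiv hint,
    Real.log_div (hpos s left_mem_uIcc).ne' hr.ne']
  ring_nf

/-- Near the smaller disk the best disk is the one that sees the point at the parameter `τ`. -/
theorem hyperbolicDensity_mul_le_of_tangent {Ω : Set ℂ} (hΩ : Convex ℝ Ω) {p q : ℂ}
    {R r d τ t : ℝ} (hr : 0 < r) (hrR : r < R) (hp : ball p R ⊆ Ω) (hq : ball q r ⊆ Ω)
    (hpq : ‖q - p‖ ≤ d) (hτ : 0 < τ) (hτ1 : τ < 1) (h : (R - r) * (1 + τ ^ 2) = 2 * τ * d)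
    (ht : R * τ ≤ d * t) (ht1 : t ≤ 1) :
    hyperbolicDensity Ω (p + t * (q - p)) * ‖q - p‖ ≤
      d / ((1 + τ ^ 2) * (R - (R - r) * t)) := by
  have hR : 0 < R := hr.trans hrR
  have hd : 0 < d := by
    have : 0 < (R - r) * (1 + τ ^ 2) := mul_pos (sub_pos.2 hrR) (by positivity)
    rw [h] at this
    exact pos_of_mul_pos_right this (by positivity)
  have hτ2 : 0 < 1 - τ ^ 2 := by nlinarith
  have hD : 0 < R - (R - r) * t := by nlinarith
  set D := R - (R - r) * t with hD_def
  -- `w` solves `d (t - w) = τ ((1 - w) R + w r)`; it is nonnegative exactly when `R τ ≤ d t`.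
  set w := (1 + τ ^ 2) * (d * t - R * τ) / (d * (1 - τ ^ 2)) with hw_def
  have hρ : (1 - w) * R + w * r = (1 + τ ^ 2) * D / (1 - τ ^ 2) := by
    have : (1 - w) * R + w * r = R - w * (R - r) := by ring
    rw [this, hw_def, hD_def]
    field_simp
    linear_combination (R * τ) * h
  have htw : d * (t - w) = τ * ((1 + τ ^ 2) * D / (1 - τ ^ 2)) := by
    rw [hw_def, hD_def]
    field_simp
    linear_combination (t * τ) * h
  have hρ0 : 0 < (1 + τ ^ 2) * D / (1 - τ ^ 2) := by positivity
  have hw0 : 0 ≤ w := by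
    have : 0 ≤ d * t - R * τ := sub_nonneg.2 ht
    positivity
  have hw1 : w ≤ 1 := by
    have h1 : 0 < d * (t - w) := htw ▸ mul_pos hτ hρ0
    nlinarith
  have h1 := hyperbolicDensity_mul_le hΩ hR hr hp hq hpq ⟨hw0, hw1⟩ (t := t) (by
    rw [hρ, show |t - w| * d = |d * (t - w)| by rw [abs_mul, abs_of_pos hd, mul_comm], htw,
      abs_of_pos (mul_pos hτ hρ0)]
    nlinarith)
  refine h1.trans_eq ?_
  rw [hρ, htw]
  field_simp

theorem hyperbolicDist_le_of_tangent {Ω : Set ℂ} (hΩ : Convex ℝ Ω) {p q : ℂ} {R r d τ : ℝ}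
    (hr : 0 < r) (hrR : r < R) (hp : ball p R ⊆ Ω) (hq : ball q r ⊆ Ω) (hpq : ‖q - p‖ ≤ d)
    (hτ : 0 < τ) (hτ1 : τ < 1) (h : (R - r) * (1 + τ ^ 2) = 2 * τ * d) (hd : R * τ < d) :
    hyperbolicDist Ω p q ≤ 1 / 2 * (τ⁻¹ * Real.log (R / r * ((1 - τ ^ 2) / (1 + τ ^ 2))) +
      Real.log ((1 + τ) / (1 - τ))) := by
  have hR : 0 < R := hr.trans hrR
  have hd0 : 0 < d := (mul_pos hR hτ).trans hd
  -- The switch point: the disk about `p` serves for `t ≤ s`, the disks at ratio `τ` afterwards.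
  set s := R * τ / d with hs_def
  have hs0 : 0 ≤ s := by positivity
  have hs1 : s ≤ 1 := ((div_lt_one hd0).2 hd).le
  have hds : d * s = R * τ := by rw [hs_def]; field_simp
  obtain ⟨hint1, heq1⟩ := integral_div_sq_sub_sq hd0.le hs0 (R := R) (by rw [hds]; nlinarith)
  obtain ⟨hint2, heq2⟩ := integral_div_sub_mul hτ hr hrR hs1 h
  let g : ℝ → ℝ := fun t => if t ≤ s then d * R / (R ^ 2 - (d * t) ^ 2)
    else d / ((1 + τ ^ 2) * (R - (R - r) * t))
  have hg1 : EqOn (fun t => d * R / (R ^ 2 - (d * t) ^ 2)) g (uIoc 0 s) := fun t ht => by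
    rw [uIoc_of_le hs0] at ht
    simp [g, ht.2]
  have hg2 : EqOn (fun t => d / ((1 + τ ^ 2) * (R - (R - r) * t))) g (uIoc s 1) := fun t ht => by
    rw [uIoc_of_le hs1] at ht
    simp [g, not_le.2 ht.1]
  have hi1 := hint1.congr hg1
  have hi2 := hint2.congr hg2
  have hle := hyperbolicDist_le_integral
    (fun t ht => hΩ.add_mul_sub_mem hR hr hp hq ht) (hi1.trans hi2) fun t ht => by
      by_cases hts : t ≤ s
      · have hdt : d * t ≤ d * s := by gcongr
        have h1 := hyperbolicDensity_mul_le hΩ hR hr hp hq hpq (w := 0) (t := t) (by simp)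
          (by rw [sub_zero, abs_of_nonneg ht.1]; nlinarith)
        simpa [g, hts] using h1
      · have hdt : d * s ≤ d * t := by gcongr; exact (not_le.1 hts).le
        simpa only [g, hts, if_false] using
          hyperbolicDensity_mul_le_of_tangent hΩ hr hrR hp hq hpq hτ hτ1 h (hds ▸ hdt) ht.2
  rw [← intervalIntegral.integral_add_adjacent_intervals hi1 hi2,
    ← intervalIntegral.integral_congr_ae (Filter.Eventually.of_forall hg1),
    ← intervalIntegral.integral_congr_ae (Filter.Eventually.of_forall hg2), heq1, heq2, hds] at hle
  have e1 : (R + R * τ) / (R - R * τ) = (1 + τ) / (1 - τ) := by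
    have : 1 - τ ≠ 0 := by linarith
    rw [show R - R * τ = R * (1 - τ) by ring]
    field_simp
  have e2 : (R - (R - r) * s) / r = R / r * ((1 - τ ^ 2) / (1 + τ ^ 2)) := by
    rw [hs_def]
    field_simp
    linear_combination (-τ) * h
  rw [e1, e2] at hle
  refine hle.trans_eq ?_
  field_simp
  ring

theorem hyperbolicDist_le_of_ball_subset {Ω : Set ℂ} (hΩ : Convex ℝ Ω) {p q : ℂ} {R r d θ : ℝ}
    (hr : 0 < r) (hrR : r < R) (hp : ball p R ⊆ Ω) (hq : ball q r ⊆ Ω) (hpq : ‖q - p‖ ≤ d)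
    (hd : R - r ≤ d) (hθ : θ = Real.arcsin ((R - r) / d)) :
    hyperbolicDist Ω p q ≤ if d ≤ R * Real.tan (θ / 2) then
      (1 / 2) * Real.log ((R + d) / (R - d))
    else
      (1 / 2) * (Real.cot (θ / 2) * Real.log (R / r * Real.cos θ)
        + Real.log ((1 + Real.tan (θ / 2)) / (1 - Real.tan (θ / 2)))) := by
  have hR : 0 < R := hr.trans hrR
  have hd0 : 0 < d := (sub_pos.2 hrR).trans_le hd
  have hsin0 : 0 < (R - r) / d := div_pos (sub_pos.2 hrR) hd0
  have hsin1 : (R - r) / d ≤ 1 := (div_le_one hd0).2 hd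
  have hsin : Real.sin θ = (R - r) / d := by
    rw [hθ, Real.sin_arcsin (by linarith) hsin1]
  have hθ0 : 0 < θ := hθ ▸ Real.arcsin_pos.2 hsin0
  have hθ1 : θ ≤ Real.pi / 2 := hθ ▸ Real.arcsin_le_pi_div_two _
  have hcos : 0 ≤ Real.cos θ := Real.cos_nonneg_of_mem_Icc ⟨by linarith, hθ1⟩
  set τ := Real.tan (θ / 2) with hτ_def
  have hτ : 0 < τ := Real.tan_pos_of_pos_of_lt_pi_div_two (by linarith) (by linarith)
  have hsin' : Real.sin θ = 2 * τ / (1 + τ ^ 2) :=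
    Real.sin_eq_two_mul_tan_half_div_one_add_tan_half_sq θ
  have hcos' : Real.cos θ = (1 - τ ^ 2) / (1 + τ ^ 2) :=
    Real.cos_eq_two_mul_tan_half_div_one_sub_tan_half_sq θ (by linarith)
  have hpos : 0 < 1 + τ ^ 2 := by positivity
  have hτ1 : τ ≤ 1 := by
    rw [hcos', le_div_iff₀ hpos] at hcos
    nlinarith
  have h : (R - r) * (1 + τ ^ 2) = 2 * τ * d := by
    rw [hsin', div_eq_div_iff hpos.ne' hd0.ne'] at hsin
    exact hsin.symm
  -- If `τ = 1` then `θ = π/2` and `d = R - r`, which falls in the first case; so the second case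
  -- has `τ < 1`.
  have hlt : τ = 1 → d < R := by
    rintro h1
    rw [h1] at h
    linarith
  split_ifs with hc
  · refine hyperbolicDist_le_of_lt_radius hΩ hr hp hq hpq ?_
    rcases hτ1.lt_or_eq with h1 | h1
    · nlinarith
    · exact hlt h1
  · rw [not_le] at hc
    have h1 : τ < 1 := hτ1.lt_of_ne fun h1 => by
      have := hlt h1
      rw [h1] at hc
      linarith
    rw [hcos', show Real.cot (θ / 2) = τ⁻¹ by rw [hτ_def, Real.tan_inv_eq_cot]]
    exact hyperbolicDist_le_of_tangent hΩ hr hrR hp hq hpq hτ h1 h hc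

/-! ### The radii and the conclusion. -/

theorem norm_add_le_of_ball_subset_ball {c : ℂ} {ρ R : ℝ} (hρ : 0 < ρ)
    (h : ball c ρ ⊆ ball 0 R) : ‖c‖ + ρ ≤ R := by
  have hcl : closedBall c ρ ⊆ closedBall 0 R := by
    rw [← closure_ball c hρ.ne']
    exact (closure_mono h).trans closure_ball_subset_closedBall
  -- A unit vector in the direction of `c`, valid also for `c = 0`; the closed disk contains `c + ρ
  -- u`, of norm `‖c‖ + ρ`.
  set u := Complex.exp (Complex.arg c * Complex.I)
  have hu : ‖u‖ = 1 := Complex.norm_exp_ofReal_mul_I _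
  have hc : ‖c‖ * u = c := Complex.norm_mul_exp_arg_mul_I c
  have hmem : ((‖c‖ + ρ : ℝ) : ℂ) * u ∈ closedBall c ρ := by
    rw [mem_closedBall_iff_norm, Complex.ofReal_add, add_mul, hc, add_sub_cancel_left, norm_mul,
      hu, Complex.norm_real, Real.norm_of_nonneg hρ.le, mul_one]
  have := mem_closedBall_zero_iff.1 (hcl hmem)
  rwa [norm_mul, hu, mul_one, Complex.norm_real, Real.norm_of_nonneg (by positivity)] at this

theorem mainTheorem2 (Ω : Set ℂ) (R_O R_I R_C : ℝ) (hΩ : RadiiCondition Ω R_O R_I R_C)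
    (a : ℂ) (ha : Metric.ball a R_C ⊆ Ω) :
    hyperbolicDist Ω 0 a ≤ radiiBound R_O R_I R_C := by
  have hC := hΩ.curvature_pos
  have hI := hΩ.inner_pos
  have hin : ball 0 R_I ⊆ Ω := hΩ.inner.1
  have hout : Ω ⊆ ball 0 R_O := hΩ.outer.1
  have haO := norm_add_le_of_ball_subset_ball hC (ha.trans hout)
  have hinout := norm_add_le_of_ball_subset_ball hI (hin.trans hout)
  rw [norm_zero, zero_add] at hinout
  have hn := norm_nonneg a
  have hpq : ‖a - 0‖ ≤ R_O - R_C := by rw [sub_zero]; linarith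
  have hpq' : ‖0 - a‖ ≤ R_O - R_C := by rw [zero_sub, norm_neg]; linarith
  -- `D(a, R_C)` contains the disk about `0` of radius `2 R_C - R_O`, and `R_I` is maximal. This
  -- gives `R - r ≤ d` when `R_C > R_I`.
  have hCI : 2 * R_C - R_O ≤ R_I := hΩ.inner.2 <|
    (ball_subset_ball' (by rw [dist_zero_left]; linarith)).trans ha
  rw [radiiBound]
  rcases lt_trichotomy R_C R_I with h | rfl | h
  · rw [max_eq_right h.le, min_eq_left h.le]
    simp only [h.ne, if_false]
    exact hyperbolicDist_le_of_ball_subset hΩ.convex hC h hin ha hpq (by linarith) rfl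
  · simp only [max_self, min_self, if_true]
    exact hyperbolicDist_le_of_radius_eq hΩ.convex hC hin ha hpq
  -- The larger disk is now the one about `a`, so the segment is traversed from `a` to `0`.
  · rw [max_eq_left h.le, min_eq_right h.le, hyperbolicDist_comm]
    simp only [h.ne, if_false]
    exact hyperbolicDist_le_of_ball_subset hΩ.convex hI h ha hin hpq' (by linarith) rfl
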